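/- Theorem 5.1. Let $C^\infty(\mathbb{R}^n)$ denote the ring of smooth functions $\mathbb{R}^n\to\mathbb{R}$. A *Weil ideal* is a proper ideal $I\subseteq C^\infty(\mathbb{R}^l)$ that contains $\mathcal{M}^r$ for some natural number $r$, where $\mathcal{M}=\{f : f(0)=0\}$ (so for $r\ge 1$, $\mathcal{M}^r$ is the ideal of functions vanishing to order $r$ at $0$). Let $p:\mathbb{R}^{l+k}\to\mathbb{R}^l$ be the projection onto the first $l$ coordinates. A *semi-Weil ideal* is an ideal $J\subseteq C^\infty(\mathbb{R}^{l+k})$ of the form $J=p^*(I)$, with $I\subseteq C^\infty(\mathbb{R}^l)$ a Weil ideal, where $p^*(I)$ is the ideal of all finite sums $\sum_i (h_i\circ p)\cdot k_i$ with $h_i\in I$ and $k_i\in C^\infty(\mathbb{R}^{l+k})$. A *convenient vector space* $Y$ is a Hausdorff, locally convex, bornological, Mackey complete real topological vector space; $Y'$ denotes the space of continuous linear functionals $Y\to\mathbb{R}$. A map $f:\mathbb{R}^n\to Y$ is *smooth* if $\phi\circ f$ is smooth for every $\phi\in Y'$, and $C^\infty(\mathbb{R}^n,Y)$ is the vector space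 of smooth maps $\mathbb{R}^n\to Y$. For an ideal $J\subseteq C^\infty(\mathbb{R}^n)$, put $$J_w(Y)=\{f\in C^\infty(\mathbb{R}^n,Y) : \phi\circ f\in J \text{ for all } \phi\in Y'\},$$ and let $J_s(Y)$ be the set of $f\in C^\infty(\mathbb{R}^n,Y)$ that can be written as a finite sum $f(x)=\sum_i h_i(x)\,k_i(x)$ with $h_i\in J$ and $k_i\in C^\infty(\mathbb{R}^n,Y)$. If $J\subseteq C^\infty(\mathbb{R}^{l+k})$ is a semi-Weil ideal and $Y$ is a convenient vector space, then $J_s(Y)=J_w(Y)$, as linear subspaces of $C^\infty(\mathbb{R}^{l+k},Y)$. -/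

import Mathlib

open scoped ContDiff Manifold Topology Pointwise

noncomputable section

/-- The ring of smooth real valued functions on `ℝⁿ`. -/
abbrev SmoothFun (n : ℕ) : Type :=
  C^∞⟮𝓘(ℝ, EuclideanSpace ℝ (Fin n)), EuclideanSpace ℝ (Fin n); 𝓘(ℝ, ℝ), ℝ⟯

/-- The ideal of smooth functions on `ℝˡ` that vanish at the origin. -/
def originIdeal (l : ℕ) : Ideal (SmoothFun l) where
  carrier := {f | f 0 = 0}
  zero_mem' := by simp
  add_mem' := by
    intro f g hf hg
    simp only [Set.mem_ofPred_eq] at hf hg ⊢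
    simp [hf, hg]
  smul_mem' := by
    intro c f hf
    simp only [Set.mem_ofPred_eq] at hf ⊢
    simp [hf]

/-- A Weil ideal is a proper ideal of `C^∞(ℝˡ)` that contains a power of the ideal of functions
vanishing at the origin. -/
def IsWeilIdeal {l : ℕ} (I : Ideal (SmoothFun l)) : Prop :=
  I ≠ ⊤ ∧ ∃ r : ℕ, originIdeal l ^ r ≤ I

/-- The projection `ℝ^(l+k) → ℝˡ` onto the first `l` coordinates. -/
def projFst (l k : ℕ) : EuclideanSpace ℝ (Fin (l + k)) →L[ℝ] EuclideanSpace ℝ (Fin l) :=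
  LinearMap.toContinuousLinearMap
    { toFun := fun x => WithLp.toLp 2 fun i => x (Fin.castAdd k i)
      map_add' := fun _ _ => rfl
      map_smul' := fun _ _ => rfl }

/-- Composition with the projection, as a ring homomorphism `C^∞(ℝˡ) → C^∞(ℝ^(l+k))`. -/
def projPullback (l k : ℕ) : SmoothFun l →+* SmoothFun (l + k) where
  toFun f := ⟨fun x => f (projFst l k x), f.contMDiff.comp (projFst l k).contMDiff⟩
  map_one' := rfl
  map_mul' _ _ := rfl
  map_zero' := rfl
  map_add' _ _ := rfl

/-- A semi-Weil ideal of `C^∞(ℝ^(l+k))` is one of the form `p^* I`, with `I` a Weil ideal of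
`C^∞(ℝˡ)` and `p` the projection: `p^* I` is the ideal of all finite sums `∑ (hᵢ ∘ p) kᵢ` with
`hᵢ ∈ I`, that is, the ideal generated by the functions `h ∘ p` with `h ∈ I`. -/
def IsSemiWeilIdeal (l k : ℕ) (J : Ideal (SmoothFun (l + k))) : Prop :=
  ∃ I : Ideal (SmoothFun l), IsWeilIdeal I ∧ J = I.map (projPullback l k)

/-- A sequence is Mackey-Cauchy if its differences `xₙ - xₘ` lie in `μₙₘ B` for a single bounded
set `B` and reals `μₙₘ` that tend to `0`. -/
def IsMackeyCauchy {Y : Type*} [AddCommGroup Y] [Module ℝ Y] [TopologicalSpace Y]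
    (x : ℕ → Y) : Prop :=
  ∃ B : Set Y, Bornology.IsVonNBounded ℝ B ∧
    ∃ μ : ℕ × ℕ → ℝ, Filter.Tendsto μ Filter.atTop (𝓝 0) ∧
      ∀ n m : ℕ, x n - x m ∈ μ (n, m) • B

/-- A convenient vector space: a Hausdorff locally convex real topological vector space that is
bornological (absolutely convex sets that absorb all bounded sets are neighbourhoods of `0`) and
Mackey complete (Mackey-Cauchy sequences converge). -/
class ConvenientSpace (Y : Type*) [AddCommGroup Y] [Module ℝ Y] [TopologicalSpace Y] : Prop
    extends IsTopologicalAddGroup Y, ContinuousSMul ℝ Y, LocallyConvexSpace ℝ Y, T2Space Y where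
  bornological : ∀ s : Set Y, AbsConvex ℝ s →
    (∀ B : Set Y, Bornology.IsVonNBounded ℝ B → Absorbs ℝ s B) → s ∈ 𝓝 0
  mackeyComplete : ∀ x : ℕ → Y, IsMackeyCauchy x → ∃ y : Y, Filter.Tendsto x Filter.atTop (𝓝 y)

section Extensions

variable (Y : Type*) [AddCommGroup Y] [Module ℝ Y] [TopologicalSpace Y]
  [IsTopologicalAddGroup Y] [ContinuousSMul ℝ Y]

/-- The vector space `C^∞(ℝⁿ, Y)`: a map `f : ℝⁿ → Y` is smooth if `φ ∘ f` is smooth for every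
continuous linear functional `φ` on `Y`. -/
def SmoothMaps (n : ℕ) : Submodule ℝ (EuclideanSpace ℝ (Fin n) → Y) where
  carrier := {f | ∀ φ : Y →L[ℝ] ℝ, ContDiff ℝ ∞ fun x => φ (f x)}
  zero_mem' := by
    intro φ
    simpa using (contDiff_const : ContDiff ℝ ∞ fun _ : EuclideanSpace ℝ (Fin n) => (0 : ℝ))
  add_mem' := by
    intro f g hf hg φ
    simpa using (hf φ).add (hg φ)
  smul_mem' := by
    intro c f hf φ
    simpa using contDiff_const.mul (hf φ)

variable {Y}

/-- The composite `φ ∘ f`, as an element of `C^∞(ℝⁿ)`. -/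
def scalarComp {n : ℕ} (φ : Y →L[ℝ] ℝ) (f : SmoothMaps Y n) : SmoothFun n :=
  ⟨fun x => φ (f.1 x), (f.2 φ).contMDiff⟩

variable (Y)

/-- The weak extension: the `f` in `C^∞(ℝⁿ, Y)` with `φ ∘ f ∈ I` for all continuous linear
functionals `φ` on `Y`. -/
def weakExt {n : ℕ} (I : Ideal (SmoothFun n)) : Submodule ℝ (SmoothMaps Y n) where
  carrier := {f | ∀ φ : Y →L[ℝ] ℝ, scalarComp φ f ∈ I}
  zero_mem' := by
    intro φ
    have h : scalarComp φ (0 : SmoothMaps Y n) = 0 := by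
      ext x
      simp [scalarComp]
    rw [h]
    exact I.zero_mem
  add_mem' := by
    intro f g hf hg φ
    have h : scalarComp φ (f + g) = scalarComp φ f + scalarComp φ g :=
      ContMDiffMap.ext fun x => map_add φ (f.1 x) (g.1 x)
    rw [h]
    exact I.add_mem (hf φ) (hg φ)
  smul_mem' := by
    intro c f hf φ
    have h : scalarComp φ (c • f) = (algebraMap ℝ (SmoothFun n) c) * scalarComp φ f := by
      rw [← Algebra.smul_def]
      exact ContMDiffMap.ext fun x => map_smul φ c (f.1 x)
    rw [h]
    exact I.mul_mem_left _ (hf φ)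

/-- The strong extension: the `f` in `C^∞(ℝⁿ, Y)` that are finite sums `∑ hᵢ kᵢ` with `hᵢ ∈ I` and
`kᵢ ∈ C^∞(ℝⁿ, Y)`. -/
def strongExt {n : ℕ} (I : Ideal (SmoothFun n)) : Submodule ℝ (SmoothMaps Y n) where
  carrier := {f | ∃ (m : ℕ) (h : Fin m → SmoothFun n) (k : Fin m → SmoothMaps Y n),
    (∀ i, h i ∈ I) ∧ ∀ x, f.1 x = ∑ i, h i x • (k i).1 x}
  zero_mem' := ⟨0, Fin.elim0, Fin.elim0, fun i => i.elim0, fun x => by simp⟩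
  add_mem' := by
    rintro f g ⟨m, h, k, hI, hf⟩ ⟨m', h', k', hI', hg⟩
    refine ⟨m + m', Fin.append h h', Fin.append k k', fun i => ?_, fun x => ?_⟩
    · refine Fin.addCases (fun j => ?_) (fun j => ?_) i
      · simpa using hI j
      · simpa using hI' j
    · simp [Fin.sum_univ_add, ← hf x, ← hg x]
  smul_mem' := by
    rintro c f ⟨m, h, k, hI, hf⟩
    refine ⟨m, h, fun i => c • k i, hI, fun x => ?_⟩
    simp [hf x, Finset.smul_sum, smul_comm c]

end Extensions

end

/-!
`C^∞(ℝˡ)` acts on the smooth maps `f : ℝ^(l+k) → Y` by `(h • f) x = h (p x) f x`, where `p` is the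
projection. Write `M` for the ideal of functions vanishing at the origin and `C` for the
`C^∞(ℝˡ)`-span of the maps that do not depend on the first `l` coordinates. The proof has three
ingredients.

* *Hadamard's lemma in `Y`* (`exists_smooth_eq_add_smul`): `f x = f (x - xᵢ eᵢ) + xᵢ g x` with `g`
  smooth. For `xᵢ ≠ 0` the value `g x` is a difference quotient. For `xᵢ = 0` it is a limit of
  difference quotients, which form a Mackey-Cauchy sequence: composed with a functional `φ` they are
  values of a smooth function (`contDiff_hadamardQuotient`), so their divided differences are weakly
  bounded, and weakly bounded sets are bounded (`isVonNBounded_of_forall_dual`). Each `φ ∘ g` is the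
  Hadamard quotient of `φ ∘ f`, hence smooth.
* *Taylor expansion* (`span_fiberConstant_sup`, `Submodule.sup_pow_smul_top_eq_top`): Hadamard's
  lemma in the first `l` coordinates says that `C` and `M • ⊤` together are everything, and
  iteration gives the same for `C` and `M ^ r • ⊤`. If `M ^ r ≤ I`, the second summand lies in the
  strong extension of `p^* I`.
* *The polynomial part* (`mem_smul_top_of_mem_weakExt`): let `c = ∑ mᵢ • aᵢ` be in the weak
  extension, with each `aᵢ` independent of the first `l` coordinates. For a linear section `σ` of
  `C^∞(ℝˡ) → C^∞(ℝˡ) ⧸ I`, the functions `mᵢ - σ [mᵢ]` lie in `I`. Restriction to the slices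
  `ℝˡ × {z}` shows `∑ φ (aᵢ z) mᵢ ∈ I`, hence `φ (∑ σ [mᵢ] • aᵢ) = 0` for every `φ`. So
  `c = ∑ (mᵢ - σ [mᵢ]) • aᵢ` by Hahn-Banach.
-/

/-! ### Smoothness of parametric integrals -/

open MeasureTheory in
lemma hasFDerivAt_integral_zero_one {E G : Type} [NormedAddCommGroup E] [NormedSpace ℝ E]
    [ProperSpace E] [NormedAddCommGroup G] [NormedSpace ℝ G]
    {F : E → ℝ → G} (hF : ContDiff ℝ 1 (Function.uncurry F)) (x₀ : E) :
    HasFDerivAt (fun x => ∫ t in (0 : ℝ)..1, F x t)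
      (∫ t in (0 : ℝ)..1, fderiv ℝ (fun x => F x t) x₀) x₀ := by
  have hd : Continuous (Function.uncurry fun x t => fderiv ℝ (fun x => F x t) x) :=
    (ContDiff.fderiv (n := 0) (m := 1) (f := fun p : E × ℝ => fun y => F y p.2)
      (hF.comp (contDiff_snd.prodMk (contDiff_snd.comp contDiff_fst)))
      contDiff_fst (by norm_num)).continuous
  obtain ⟨C, hC⟩ := ((isCompact_closedBall x₀ 1).prod (isCompact_Icc (a := (0 : ℝ)) (b := 1))
    ).exists_bound_of_continuousOn hd.continuousOn
  have hcF : ∀ x, Continuous (F x) := fun x => hF.continuous.comp (Continuous.prodMk_right x)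
  refine intervalIntegral.hasFDerivAt_integral_of_dominated_of_fderiv_le (𝕜 := ℝ) (μ := volume)
    (F' := fun x t => fderiv ℝ (fun x => F x t) x)
    (s := Metric.closedBall x₀ 1) (bound := fun _ => C)
    (Metric.closedBall_mem_nhds x₀ one_pos) (.of_forall fun x => (hcF x).aestronglyMeasurable)
    ((hcF x₀).intervalIntegrable _ _) ?_ ?_
    (continuous_const.intervalIntegrable 0 1) ?_
  · exact Continuous.aestronglyMeasurable (hd.comp (Continuous.prodMk_right x₀))
  · refine .of_forall fun t ht x hx => hC (x, t) ⟨hx, ?_⟩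
    rw [Set.uIoc_of_le zero_le_one] at ht
    exact Set.Ioc_subset_Icc_self ht
  · refine .of_forall fun t _ x _ => ?_
    have : ContDiff ℝ 1 fun x => F x t := hF.comp (contDiff_id.prodMk contDiff_const)
    exact (this.differentiable (by norm_num) x).hasFDerivAt

/-- The integral over `[0, 1]` of a smooth function depends smoothly on the parameter. The induction
replaces `G` by `E →L[ℝ] G`, so both spaces are taken in the same universe as `ℝ`. -/
lemma contDiff_integral_zero_one {E : Type} [NormedAddCommGroup E] [NormedSpace ℝ E]
    [ProperSpace E] (n : ℕ) {G : Type} [NormedAddCommGroup G] [NormedSpace ℝ G]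
    {F : E → ℝ → G} (hF : ContDiff ℝ ∞ (Function.uncurry F)) :
    ContDiff ℝ n fun x => ∫ t in (0 : ℝ)..1, F x t := by
  have h1 : ContDiff ℝ 1 (Function.uncurry F) := hF.of_le (by exact_mod_cast le_top)
  induction n generalizing G with
  | zero =>
    exact contDiff_zero.2 (continuous_iff_continuousAt.2 fun x =>
      (hasFDerivAt_integral_zero_one h1 x).continuousAt)
  | succ n ih =>
    have hd : ContDiff ℝ ∞ (Function.uncurry fun x t => fderiv ℝ (fun x => F x t) x) :=
      ContDiff.fderiv (m := ∞) (n := ∞) (f := fun p : E × ℝ => fun y => F y p.2)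
        (hF.comp (contDiff_snd.prodMk (contDiff_snd.comp contDiff_fst)))
        contDiff_fst (by simp)
    push_cast
    exact contDiff_succ_iff_hasFDerivAt.2 ⟨_, ih hd (hd.of_le (by exact_mod_cast le_top)),
      hasFDerivAt_integral_zero_one h1⟩

/-! ### Hadamard quotients of real valued functions -/

section HadamardQuotient

variable {E : Type} [NormedAddCommGroup E] [NormedSpace ℝ E]

/-- The quotient `(u x - u (x - ξ x • e)) / ξ x`, extended across the hyperplane `ξ = 0` by writing
it as the average of the derivative of `u` in the direction `e` along the segment. -/
noncomputable def hadamardQuotient (ξ : E →L[ℝ] ℝ) (e : E) (u : E → ℝ) (x : E) : ℝ :=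
  ∫ t in (0 : ℝ)..1, fderiv ℝ u (x - (t * ξ x) • e) e

lemma contDiff_hadamardQuotient [ProperSpace E] (ξ : E →L[ℝ] ℝ) (e : E) {u : E → ℝ}
    (hu : ContDiff ℝ ∞ u) : ContDiff ℝ ∞ (hadamardQuotient ξ e u) := by
  refine contDiff_infty.2 fun n => contDiff_integral_zero_one n ?_
  have h1 : ContDiff ℝ ∞ (fderiv ℝ u) := hu.fderiv_right (by simp)
  have h2 : ContDiff ℝ ∞ fun p : E × ℝ => p.1 - (p.2 * ξ p.1) • e := by fun_prop
  exact (h1.comp h2).clm_apply contDiff_const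

lemma sub_eq_mul_hadamardQuotient (ξ : E →L[ℝ] ℝ) (e : E) {u : E → ℝ}
    (hu : ContDiff ℝ ∞ u) (x : E) :
    u x - u (x - ξ x • e) = ξ x * hadamardQuotient ξ e u x := by
  have hd : ∀ t : ℝ, HasDerivAt (fun t : ℝ => u (x - (t * ξ x) • e))
      (-(ξ x * fderiv ℝ u (x - (t * ξ x) • e) e)) t := by
    intro t
    have hl : HasDerivAt (fun t : ℝ => x - (t * ξ x) • e) (-(ξ x • e)) t := by
      simpa using (((hasDerivAt_id t).mul_const (ξ x)).smul_const e).const_sub x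
    have := ((hu.differentiable (by simp) (x - (t * ξ x) • e)).hasFDerivAt).comp_hasDerivAt t hl
    simpa [Function.comp_def] using! this
  have hc : Continuous fun t : ℝ => -(ξ x * fderiv ℝ u (x - (t * ξ x) • e) e) := by
    have := hu.continuous_fderiv (by simp)
    fun_prop
  have := intervalIntegral.integral_eq_sub_of_hasDerivAt (fun t _ => hd t)
    (hc.intervalIntegrable 0 1)
  simp only [intervalIntegral.integral_neg, intervalIntegral.integral_const_mul, one_mul, zero_mul,
    zero_smul, sub_zero] at this
  rw [hadamardQuotient]
  linarith

end HadamardQuotient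

/-! ### Weakly bounded sets -/

section WeaklyBounded

/-- If every functional dominated by a multiple of `p` is bounded on `s`, then `p` is bounded on
`s`: Banach-Steinhaus in the dual of the seminormed space `(E, p)`, which is complete. -/
lemma Seminorm.exists_forall_le_of_forall_dual {E : Type*} [AddCommGroup E] [Module ℝ E]
    (p : Seminorm ℝ E) (s : Set E)
    (h : ∀ φ : E →ₗ[ℝ] ℝ, (∃ C, ∀ x, |φ x| ≤ C * p x) → ∃ C, ∀ x ∈ s, |φ x| ≤ C) :
    ∃ C, ∀ x ∈ s, p x ≤ C := by
  let _ : SeminormedAddCommGroup E := p.toAddGroupSeminorm.toSeminormedAddCommGroup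
  have hn : ∀ x : E, ‖x‖ = p x := fun _ => rfl
  let _ : NormedSpace ℝ E := ⟨fun a b => by simp only [hn, map_smul_eq_mul]; rfl⟩
  obtain ⟨C, hC⟩ := banach_steinhaus (g := fun x : s => NormedSpace.inclusionInDoubleDual ℝ E x) (by
    intro φ
    obtain ⟨C, hC⟩ := h φ.toLinearMap ⟨‖φ‖, fun x => φ.le_opNorm x⟩
    exact ⟨C, fun x => by simpa using! hC x x.2⟩)
  refine ⟨C, fun x hx => ?_⟩
  by_cases h0 : ‖x‖ = 0
  · rw [← hn, h0]; exact (norm_nonneg _).trans (hC ⟨x, hx⟩)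
  obtain ⟨g, hg, hgx⟩ := exists_dual_vector ℝ x h0
  have h1 := (NormedSpace.inclusionInDoubleDual ℝ E x).le_opNorm g
  rw [NormedSpace.dual_def, hgx, hg, mul_one] at h1
  have h2 : ‖x‖ ≤ ‖NormedSpace.inclusionInDoubleDual ℝ E x‖ := by simpa using! h1
  exact h2.trans (hC ⟨x, hx⟩)

variable {Y : Type*} [AddCommGroup Y] [Module ℝ Y] [TopologicalSpace Y]

/-- Mackey's theorem: in a locally convex space, weakly bounded sets are bounded. -/
lemma isVonNBounded_of_forall_dual [IsTopologicalAddGroup Y] [ContinuousSMul ℝ Y]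
    [LocallyConvexSpace ℝ Y] (s : Set Y)
    (h : ∀ φ : Y →L[ℝ] ℝ, ∃ C, ∀ x ∈ s, |φ x| ≤ C) : Bornology.IsVonNBounded ℝ s := by
  rw [(with_gaugeSeminormFamily (𝕜 := ℝ) (E := Y)).isVonNBounded_iff_seminorm_bddAbove]
  intro i
  obtain ⟨C, hC⟩ := Seminorm.exists_forall_le_of_forall_dual (gaugeSeminormFamily ℝ Y i) s (by
    rintro φ ⟨C, hC⟩
    have hc : Continuous φ := by
      refine continuous_of_continuousAt_zero φ ?_
      have hp := ((with_gaugeSeminormFamily (𝕜 := ℝ) (E := Y)).continuous_seminorm i).tendsto' 0 0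
        (map_zero _)
      rw [ContinuousAt, map_zero]
      exact squeeze_zero_norm hC (by simpa using hp.const_mul C)
    exact h ⟨φ, hc⟩)
  exact ⟨C, by rintro _ ⟨x, hx, rfl⟩; exact hC x hx⟩

lemma eq_of_forall_dual_eq [ConvenientSpace Y] {x y : Y} (h : ∀ φ : Y →L[ℝ] ℝ, φ x = φ y) :
    x = y := by
  by_contra hxy
  obtain ⟨φ, hφ⟩ := geometric_hahn_banach_point_point hxy
  exact hφ.ne (h φ)

end WeaklyBounded

/-! ### Hadamard's lemma in convenient vector spaces -/

section Hadamard

variable {Y : Type*} [AddCommGroup Y] [Module ℝ Y] [TopologicalSpace Y]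
  {E : Type} [NormedAddCommGroup E] [NormedSpace ℝ E] [ProperSpace E]

open Filter in
/-- The Hadamard quotients of the functions `φ ∘ f` at `x` are the values of a single vector of `Y`.
Off the hyperplane `ξ = 0` this is a difference quotient of `f`. On it, the difference quotients at
`x + s e` converge as `s → 0`, by Mackey completeness. -/
lemma exists_forall_dual_eq_hadamardQuotient [ConvenientSpace Y] (ξ : E →L[ℝ] ℝ) (e : E)
    (he : ξ e = 1) (f : E → Y) (hf : ∀ φ : Y →L[ℝ] ℝ, ContDiff ℝ ∞ fun x => φ (f x)) (x : E) :
    ∃ y : Y, ∀ φ : Y →L[ℝ] ℝ, φ y = hadamardQuotient ξ e (fun x => φ (f x)) x := by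
  by_cases hx : ξ x = 0
  swap
  · refine ⟨(ξ x)⁻¹ • (f x - f (x - ξ x • e)), fun φ => ?_⟩
    have := sub_eq_mul_hadamardQuotient ξ e (hf φ) x
    simp only [map_smul, map_sub, smul_eq_mul]
    rw [this, inv_mul_cancel_left₀ hx]
  set s : ℕ → ℝ := fun n => 1 / ((n : ℝ) + 1)
  have hspos : ∀ n, 0 < s n := fun n => by positivity
  have hs0 : Tendsto s atTop (𝓝 0) := tendsto_one_div_add_atTop_nhds_zero_nat
  set q : ℕ → Y := fun n => (s n)⁻¹ • (f (x + s n • e) - f x) with hq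
  set H : (Y →L[ℝ] ℝ) → ℝ → ℝ :=
    fun φ t => hadamardQuotient ξ e (fun x => φ (f x)) (x + t • e) with hH
  have hHs : ∀ φ, ContDiff ℝ ∞ (H φ) := fun φ =>
    (contDiff_hadamardQuotient ξ e (hf φ)).comp (by fun_prop)
  have hφq : ∀ φ n, φ (q n) = H φ (s n) := by
    intro φ n
    have := sub_eq_mul_hadamardQuotient ξ e (hf φ) (x + s n • e)
    simp only [map_add, map_smul, hx, he, smul_eq_mul, mul_one, zero_add, add_sub_cancel_right]
      at this
    simp only [hq, hH, map_smul, map_sub, smul_eq_mul]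
    rw [this, inv_mul_cancel_left₀ (hspos n).ne']
  obtain ⟨y, hy⟩ := ConvenientSpace.mackeyComplete q (by
    refine ⟨Set.range fun p : ℕ × ℕ => (s p.1 - s p.2)⁻¹ • (q p.1 - q p.2), ?_,
      fun p => s p.1 - s p.2, ?_, ?_⟩
    · refine isVonNBounded_of_forall_dual _ fun φ => ?_
      -- The functional `φ` maps `q n` to `H φ (s n)`, and `H φ` is Lipschitz on `[0, 1]`.
      obtain ⟨K, hK⟩ := (((hHs φ).of_le (by exact_mod_cast le_top) :
        ContDiff ℝ 1 (H φ)).locallyLipschitz.locallyLipschitzOn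
          (s := Set.Icc 0 1)).exists_lipschitzOnWith_of_compact isCompact_Icc
      refine ⟨K, ?_⟩
      rintro _ ⟨⟨n, m⟩, rfl⟩
      have hmem : ∀ n, s n ∈ Set.Icc (0 : ℝ) 1 := fun n =>
        ⟨(hspos n).le, (div_le_one (by positivity)).2 (by linarith [Nat.cast_nonneg (α := ℝ) n])⟩
      have h1 := hK.dist_le_mul _ (hmem n) _ (hmem m)
      rw [Real.dist_eq, Real.dist_eq] at h1
      simp only [map_smul, map_sub, hφq, smul_eq_mul, abs_mul, abs_inv]
      exact inv_mul_le_of_le_mul₀ (abs_nonneg _) K.2 (by rw [mul_comm]; exact h1)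
    · have := (hs0.comp tendsto_fst).sub (hs0.comp tendsto_snd)
      rw [prod_atTop_atTop_eq, sub_zero] at this
      exact this
    · intro n m
      refine Set.mem_smul_set.2 ⟨_, ⟨(n, m), rfl⟩, ?_⟩
      -- If `s n = s m`, the factor `μ (n, m)` is `0`, so `q n - q m` has to vanish.
      rcases eq_or_ne (s n) (s m) with h | h
      · have : q n = q m := by
          refine eq_of_forall_dual_eq fun φ => ?_
          rw [hφq, hφq, h]
        simp [this]
      · exact smul_inv_smul₀ (sub_ne_zero.2 h) _)
  refine ⟨y, fun φ => ?_⟩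
  have h1 : Tendsto (fun n => φ (q n)) atTop (𝓝 (φ y)) := (φ.continuous.tendsto y).comp hy
  have h2 : Tendsto (fun n => φ (q n)) atTop (𝓝 (H φ 0)) := by
    simp only [hφq]
    exact ((hHs φ).continuous.tendsto 0).comp hs0
  simpa [hH] using tendsto_nhds_unique h1 h2

/-- Hadamard's lemma for maps into a convenient vector space that are smooth in the weak sense. -/
lemma exists_smooth_eq_add_smul [ConvenientSpace Y] (ξ : E →L[ℝ] ℝ) (e : E)
    (he : ξ e = 1) (f : E → Y) (hf : ∀ φ : Y →L[ℝ] ℝ, ContDiff ℝ ∞ fun x => φ (f x)) :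
    ∃ g : E → Y, (∀ φ : Y →L[ℝ] ℝ, ContDiff ℝ ∞ fun x => φ (g x)) ∧
      ∀ x, f x = f (x - ξ x • e) + ξ x • g x := by
  choose g hg using exists_forall_dual_eq_hadamardQuotient ξ e he f hf
  refine ⟨g, fun φ => ?_, fun x => eq_of_forall_dual_eq fun φ => ?_⟩
  · simp only [hg]
    exact contDiff_hadamardQuotient ξ e (hf φ)
  · have := sub_eq_mul_hadamardQuotient ξ e (hf φ) x
    rw [map_add, map_smul, hg, smul_eq_mul]
    linarith

end Hadamard

/-! ### Submodules and powers of ideals -/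

/-- If `N` and `I • M` span `M`, so do `N` and `I ^ r • M`. -/
lemma Submodule.sup_pow_smul_top_eq_top {R M : Type*} [CommRing R] [AddCommGroup M] [Module R M]
    (N : Submodule R M) (I : Ideal R) (h : N ⊔ I • ⊤ = ⊤) (r : ℕ) :
    N ⊔ I ^ r • (⊤ : Submodule R M) = ⊤ := by
  induction r with
  | zero => simp
  | succ r ih =>
    have h1 : I ^ r • (⊤ : Submodule R M) ≤ N ⊔ I ^ (r + 1) • ⊤ :=
      calc I ^ r • (⊤ : Submodule R M) = I ^ r • (N ⊔ I • ⊤) := by rw [h]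
        _ = I ^ r • N ⊔ I ^ (r + 1) • ⊤ := by
          rw [Submodule.smul_sup, ← Submodule.smul_assoc, smul_eq_mul, pow_succ]
        _ ≤ N ⊔ I ^ (r + 1) • ⊤ := sup_le_sup_right Submodule.smul_le_right _
    exact top_le_iff.1 (ih.symm.le.trans (sup_le le_sup_left h1))

/-! ### Slices of the projection -/

section Slices

variable (l k : ℕ)

/-- The inclusion `ℝˡ → ℝ^(l+k)` of the first `l` coordinates. -/
noncomputable def inclFst : EuclideanSpace ℝ (Fin l) →L[ℝ] EuclideanSpace ℝ (Fin (l + k)) :=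
  ∑ j, (EuclideanSpace.proj j).smulRight (EuclideanSpace.single (Fin.castAdd k j) (1 : ℝ))

variable {l k}

@[simp] lemma projFst_apply (x : EuclideanSpace ℝ (Fin (l + k))) (j : Fin l) :
    projFst l k x j = x (Fin.castAdd k j) := rfl

lemma inclFst_apply (y : EuclideanSpace ℝ (Fin l)) :
    inclFst l k y = ∑ j, y j • EuclideanSpace.single (Fin.castAdd k j) (1 : ℝ) := by
  simp [inclFst]

@[simp] lemma projFst_inclFst (y : EuclideanSpace ℝ (Fin l)) :
    projFst l k (inclFst l k y) = y := by
  ext i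
  simp [inclFst_apply]

variable (l k) in
/-- Restriction to the slice `ℝˡ × {z₂}` through `z = (z₁, z₂)`, as a ring homomorphism
`C^∞(ℝ^(l+k)) → C^∞(ℝˡ)`. It does not depend on `z₁`. -/
noncomputable def restrictSlice (z : EuclideanSpace ℝ (Fin (l + k))) :
    SmoothFun (l + k) →+* SmoothFun l where
  toFun f := ⟨fun y => f (z + inclFst l k (y - projFst l k z)), f.contMDiff.comp
    (ContDiff.contMDiff (by fun_prop))⟩
  map_one' := rfl
  map_mul' _ _ := rfl
  map_zero' := rfl
  map_add' _ _ := rfl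

lemma restrictSlice_apply (z : EuclideanSpace ℝ (Fin (l + k))) (f : SmoothFun (l + k))
    (y : EuclideanSpace ℝ (Fin l)) :
    restrictSlice l k z f y = f (z + inclFst l k (y - projFst l k z)) := rfl

lemma projPullback_apply (h : SmoothFun l) (x : EuclideanSpace ℝ (Fin (l + k))) :
    projPullback l k h x = h (projFst l k x) := rfl

lemma restrictSlice_projPullback (z : EuclideanSpace ℝ (Fin (l + k))) (h : SmoothFun l) :
    restrictSlice l k z (projPullback l k h) = h :=
  ContMDiffMap.ext fun y => by simp [restrictSlice_apply, projPullback_apply]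

lemma restrictSlice_mem {I : Ideal (SmoothFun l)} {g : SmoothFun (l + k)}
    (hg : g ∈ I.map (projPullback l k)) (z : EuclideanSpace ℝ (Fin (l + k))) :
    restrictSlice l k z g ∈ I := by
  have : I.map (projPullback l k) ≤ I.comap (restrictSlice l k z) :=
    Ideal.map_le_iff_le_comap.2 fun h hh => by
      simpa [restrictSlice_projPullback] using hh
  exact this hg

end Slices

/-! ### Smooth maps as a module over the functions on the base -/

section Module

variable {Y : Type*} [AddCommGroup Y] [Module ℝ Y] [TopologicalSpace Y] {l k : ℕ}

/-- The action of `C^∞(ℝˡ)` on `C^∞(ℝ^(l+k), Y)` through the projection. -/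
noncomputable instance : SMul (SmoothFun l) (SmoothMaps Y (l + k)) where
  smul h f := ⟨fun x => h (projFst l k x) • f.1 x, fun φ => by
    simpa using ((h.contMDiff.contDiff.comp (projFst l k).contDiff).mul (f.2 φ))⟩

lemma SmoothMaps.smul_apply (h : SmoothFun l) (f : SmoothMaps Y (l + k))
    (x : EuclideanSpace ℝ (Fin (l + k))) : (h • f).1 x = h (projFst l k x) • f.1 x := rfl

noncomputable instance : Module (SmoothFun l) (SmoothMaps Y (l + k)) where
  one_smul _ := Subtype.ext <| funext fun _ => one_smul ℝ _
  mul_smul _ _ _ := Subtype.ext <| funext fun _ => mul_smul (_ : ℝ) _ _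
  smul_zero _ := Subtype.ext <| funext fun _ => smul_zero (_ : ℝ)
  smul_add _ _ _ := Subtype.ext <| funext fun _ => smul_add (_ : ℝ) _ _
  add_smul _ _ _ := Subtype.ext <| funext fun _ => add_smul (_ : ℝ) _ _
  zero_smul _ := Subtype.ext <| funext fun _ => zero_smul ℝ _

lemma strongExt_le_weakExt {n : ℕ} (J : Ideal (SmoothFun n)) : strongExt Y J ≤ weakExt Y J := by
  rintro f ⟨m, h, g, hJ, hf⟩ φ
  have : scalarComp φ f = ∑ i, h i * scalarComp φ (g i) :=
    ContMDiffMap.ext fun x => by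
      have h1 : (∑ i, h i * scalarComp φ (g i)) x = ∑ i, h i x * φ ((g i).1 x) :=
        map_sum (ContMDiffMap.evalRingHom x) _ _
      rw [h1]
      simp [scalarComp, hf x]
  rw [this]
  exact J.sum_mem fun i _ => J.mul_mem_right _ (hJ i)

lemma SmoothFun.sum_smul_apply {n N : ℕ} (c : Fin N → ℝ) (h : Fin N → SmoothFun n)
    (x : EuclideanSpace ℝ (Fin n)) : (∑ i, c i • h i) x = ∑ i, c i * h i x :=
  map_sum (ContMDiffMap.evalRingHom x) _ _

lemma SmoothMaps.sum_smul_apply {N : ℕ} (h : Fin N → SmoothFun l) (a : Fin N → SmoothMaps Y (l + k))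
    (x : EuclideanSpace ℝ (Fin (l + k))) :
    (∑ i, h i • a i).1 x = ∑ i, h i (projFst l k x) • (a i).1 x := by
  simp [SmoothMaps.smul_apply, Finset.sum_apply]

/-- Every element of `I • ⊤` is a sum of products `(h ∘ p) g` with `h ∈ I`. -/
lemma mem_strongExt_of_mem_smul_top (I : Ideal (SmoothFun l)) {f : SmoothMaps Y (l + k)}
    (hf : f ∈ I • (⊤ : Submodule (SmoothFun l) (SmoothMaps Y (l + k)))) :
    f ∈ strongExt Y (I.map (projPullback l k)) := by
  refine Submodule.smul_induction_on hf (fun h hh g _ => ?_) fun _ _ => add_mem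
  exact ⟨1, fun _ => projPullback l k h, fun _ => g, fun _ => Ideal.mem_map_of_mem _ hh,
    fun x => by simp [SmoothMaps.smul_apply, projPullback_apply]⟩

variable (Y l k) in
/-- The smooth maps on `ℝ^(l+k)` that do not depend on the first `l` coordinates. -/
def fiberConstant : Set (SmoothMaps Y (l + k)) :=
  {f | ∀ x y, f.1 (x + inclFst l k y) = f.1 x}

end Module

/-! ### Taylor expansion and the polynomial part -/

section Convenient

variable {Y : Type*} [AddCommGroup Y] [Module ℝ Y] [TopologicalSpace Y]
  [ConvenientSpace Y] {l k : ℕ}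

/-- Modulo `M • ⊤`, the first `l` coordinates of the argument may be set to `0`, here those in a
finite set `s`. -/
lemma exists_sub_mem_originIdeal_smul_top (f : SmoothMaps Y (l + k)) (s : Finset (Fin l)) :
    ∃ g : SmoothMaps Y (l + k), (∀ x, g.1 x = f.1 (x - ∑ j ∈ s, x (Fin.castAdd k j) •
        EuclideanSpace.single (Fin.castAdd k j) (1 : ℝ))) ∧
      f - g ∈ originIdeal l • (⊤ : Submodule (SmoothFun l) (SmoothMaps Y (l + k))) := by
  induction s using Finset.induction_on with
  | empty => exact ⟨f, fun x => by simp, by simp⟩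
  | insert i s hi ih =>
    obtain ⟨g, hg, hfg⟩ := ih
    set e : EuclideanSpace ℝ (Fin (l + k)) :=
      EuclideanSpace.single (Fin.castAdd k i) (1 : ℝ) with he
    obtain ⟨q, hq, hgq⟩ := exists_smooth_eq_add_smul (EuclideanSpace.proj (Fin.castAdd k i) :
      EuclideanSpace ℝ (Fin (l + k)) →L[ℝ] ℝ) e (by simp [he]) g.1 g.2
    replace hgq : ∀ x : EuclideanSpace ℝ (Fin (l + k)),
      g.1 x = g.1 (x - x (Fin.castAdd k i) • e) + x (Fin.castAdd k i) • q x := hgq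
    let h : SmoothFun l := ⟨fun y => y i, (EuclideanSpace.proj i :
      EuclideanSpace ℝ (Fin l) →L[ℝ] ℝ).contMDiff⟩
    have hh : h ∈ originIdeal l := show (0 : EuclideanSpace ℝ (Fin l)) i = 0 by simp
    let q' : SmoothMaps Y (l + k) := ⟨q, hq⟩
    refine ⟨g - h • q', fun x => ?_, ?_⟩
    · have h1 : (g - h • q').1 x = g.1 (x - x (Fin.castAdd k i) • e) :=
        sub_eq_iff_eq_add.2 (hgq x)
      have h2 : ∀ j ∈ s, (x - x (Fin.castAdd k i) • e) (Fin.castAdd k j) •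
          EuclideanSpace.single (Fin.castAdd k j) (1 : ℝ) =
          x (Fin.castAdd k j) • EuclideanSpace.single (Fin.castAdd k j) (1 : ℝ) := by
        intro j hj
        have : j ≠ i := fun h => hi (h ▸ hj)
        simp [he, this]
      rw [h1, hg, Finset.sum_insert hi, sub_sub, Finset.sum_congr rfl h2]
    · rw [← sub_add]
      exact add_mem hfg (Submodule.smul_mem_smul hh trivial)

/-- First order Taylor expansion in the first `l` coordinates. -/
lemma span_fiberConstant_sup (Y : Type*) [AddCommGroup Y] [Module ℝ Y] [TopologicalSpace Y]
    [ConvenientSpace Y] (l k : ℕ) : Submodule.span (SmoothFun l) (fiberConstant Y l k) ⊔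
      originIdeal l • (⊤ : Submodule (SmoothFun l) (SmoothMaps Y (l + k))) = ⊤ := by
  refine eq_top_iff.2 fun f _ => ?_
  obtain ⟨g, hg, hfg⟩ := exists_sub_mem_originIdeal_smul_top f Finset.univ
  refine Submodule.mem_sup.2 ⟨g, Submodule.subset_span fun x y => ?_, _, hfg, by abel⟩
  have h1 : ∀ x, g.1 x = f.1 (x - inclFst l k (projFst l k x)) := fun x => by
    rw [hg, inclFst_apply]; rfl
  rw [h1, h1]
  simp

/-- On the span of the maps that do not depend on the first `l` coordinates, the weak extension of
`p^* I` is contained in the strong one, for every ideal `I`. -/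
lemma mem_smul_top_of_mem_weakExt (I : Ideal (SmoothFun l)) {f : SmoothMaps Y (l + k)}
    (hf : f ∈ weakExt Y (I.map (projPullback l k)))
    (hs : f ∈ Submodule.span (SmoothFun l) (fiberConstant Y l k)) :
    f ∈ I • (⊤ : Submodule (SmoothFun l) (SmoothMaps Y (l + k))) := by
  obtain ⟨N, m, a, rfl⟩ := Submodule.mem_span_set'.1 hs
  let π := (I.restrictScalars ℝ).mkQ
  obtain ⟨σ, hσ⟩ := π.exists_rightInverse_of_surjective (Submodule.range_mkQ _)
  have hσ' : ∀ w, π (σ w) = w := fun w => LinearMap.congr_fun hσ w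
  have hmem : ∀ i, m i - σ (π (m i)) ∈ I := fun i =>
    (Submodule.Quotient.mk_eq_zero (I.restrictScalars ℝ)).1 (by
      change π _ = 0
      rw [map_sub, hσ', sub_self])
  have hzero : ∑ i, σ (π (m i)) • (a i : SmoothMaps Y (l + k)) = 0 := by
    refine Subtype.ext (funext fun x => eq_of_forall_dual_eq fun φ => ?_)
    -- This is the restriction of `φ ∘ ∑ m i • a i` to the slice through `x`, on which each `a i`
    -- is constant.
    have hw : ∑ i, φ ((a i).1.1 x) • m i ∈ I := by
      convert restrictSlice_mem (hf φ) x using 1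
      refine ContMDiffMap.ext fun y => ?_
      have h1 : ∀ i, (a i).1.1 (x + (inclFst l k y - inclFst l k (projFst l k x))) =
          (a i).1.1 x := fun i => by rw [← map_sub]; exact (a i).2 _ _
      rw [restrictSlice_apply, SmoothFun.sum_smul_apply]
      simp [scalarComp, SmoothMaps.sum_smul_apply, h1, mul_comm]
    have hπ : π (∑ i, φ ((a i).1.1 x) • m i) = 0 :=
      (Submodule.Quotient.mk_eq_zero (I.restrictScalars ℝ)).2 hw
    have h2 := congrArg (fun w => σ w (projFst l k x)) hπ
    simp only [map_sum, map_smul, map_zero, SmoothFun.sum_smul_apply] at h2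
    rw [SmoothMaps.sum_smul_apply, map_sum]
    refine (Finset.sum_congr rfl fun i _ => ?_).trans (h2.trans (map_zero φ).symm)
    rw [map_smul, smul_eq_mul, mul_comm]
  have : ∑ i, m i • (a i : SmoothMaps Y (l + k)) =
      ∑ i, (m i - σ (π (m i))) • (a i : SmoothMaps Y (l + k)) := by
    rw [Finset.sum_congr rfl fun i _ => sub_smul (m i) (σ (π (m i))) (a i : SmoothMaps Y (l + k)),
      Finset.sum_sub_distrib, hzero, sub_zero]
  rw [this]
  exact sum_mem fun i _ => Submodule.smul_mem_smul (hmem i) trivial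

end Convenient

theorem theorem5p1 (l k : ℕ) (J : Ideal (SmoothFun (l + k))) (hJ : IsSemiWeilIdeal l k J)
    (Y : Type*) [AddCommGroup Y] [Module ℝ Y] [TopologicalSpace Y] [ConvenientSpace Y] :
    strongExt Y J = weakExt Y J := by
  obtain ⟨I, ⟨-, r, hr⟩, rfl⟩ := hJ
  refine le_antisymm (strongExt_le_weakExt _) fun f hf => ?_
  have hf' : f ∈ Submodule.span (SmoothFun l) (fiberConstant Y l k) ⊔
      originIdeal l ^ r • (⊤ : Submodule (SmoothFun l) (SmoothMaps Y (l + k))) := by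
    rw [Submodule.sup_pow_smul_top_eq_top _ _ (span_fiberConstant_sup Y l k)]
    trivial
  obtain ⟨c, hc, s, hs, rfl⟩ := Submodule.mem_sup.1 hf'
  have hs' := mem_strongExt_of_mem_smul_top I (Submodule.smul_mono_left hr hs)
  have hcw : c ∈ weakExt Y (I.map (projPullback l k)) := by
    simpa using sub_mem hf (strongExt_le_weakExt _ hs')
  exact add_mem (mem_strongExt_of_mem_smul_top I (mem_smul_top_of_mem_weakExt I hcw hc)) hs'
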